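/- For integers $k,n\ge 0$ let $p_{\pm 3^{k}(3^{k+1}),3}(n)$ denote the number of $2$-color partition triples of $n$ in which one of the two colors appears only in parts congruent to $\pm 3^{k}$ modulo $3^{k+1}$; equivalently, with $E(q)=\prod_{m\ge 1}(1-q^{m})$, $$\sum_{n\ge 0}p_{\pm 3^{k}(3^{k+1}),3}(n)\,q^{n}=\frac{1}{E(q)^{3}}\prod_{\substack{m\ge 1\\ m\equiv \pm 3^{k}\ (\mathrm{mod}\ 3^{k+1})}}\frac{1}{(1-q^{m})^{3}}=\frac{E(q^{3^{k+1}})^{3}}{E(q)^{3}\,E(q^{3^{k}})^{3}}.$$ Then for all integers $\alpha,\beta,n\ge 0$, $$p_{\pm3^{2\alpha+1}(3^{2\alpha+2}),3}\left(3^{2\alpha+2\beta+1}n+\frac{7\cdot3^{2\alpha+2\beta+1}-2\cdot3^{2\alpha+1}+1}{8}\right)\equiv 0 \pmod{3^{3\alpha+3\beta+2}},$$ $$p_{\pm3^{2\alpha+1}(3^{2\alpha+2}),3}\left(3^{2\alpha+2\beta+2}n+\frac{23\cdot3^{2\alpha+2\beta+1}-2\cdot3^{2\alpha+1}+1}{8}\right)\equiv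 0 \pmod{3^{3\alpha+3\beta+4}},$$ $$p_{\pm3^{2\alpha+1}(3^{2\alpha+2}),3}\left(3^{2\alpha+2\beta+2}n+\frac{5\cdot3^{2\alpha+2\beta+2}-2\cdot3^{2\alpha+1}+1}{8}\right)\equiv 0 \pmod{3^{3\alpha+3\beta+3}},$$ $$p_{\pm3^{2\alpha+1}(3^{2\alpha+2}),3}\left(3^{2\alpha+2\beta+3}n+\frac{13\cdot3^{2\alpha+2\beta+2}-2\cdot3^{2\alpha+1}+1}{8}\right)\equiv 0 \pmod{3^{3\alpha+3\beta+4}}.$$ -/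

import Mathlib

/-- The residue condition `m ≡ ±3 ^ k (mod 3 ^ (k + 1))`. -/
abbrev IsPMPow (k m : ℕ) : Prop :=
  (m : ℤ) ≡ 3 ^ k [ZMOD 3 ^ (k + 1)] ∨ (m : ℤ) ≡ -3 ^ k [ZMOD 3 ^ (k + 1)]

/-- The 2-color partition triples of `n` in which the second color appears only in parts
that are congruent to `±3 ^ k` modulo `3 ^ (k + 1)`.
An index `j = (c, i)` stands for the parts of color `c` in the `i`-th member of the triple:
`a` distributes `n` among the six indices (its values have sum `n`), and a partition of
`a j` is chosen for each `j`; those of the second color (`c = 1`) have restricted parts. -/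
abbrev TwoColorTriple (k n : ℕ) : Type :=
  Σ a : {a : Fin 2 × Fin 3 → ℕ // a ∈ Finset.piAntidiag Finset.univ n},
    ∀ j : Fin 2 × Fin 3,
      {P : Nat.Partition (a.1 j) // j.1 = 1 → ∀ m ∈ P.parts, IsPMPow k m}

/-- The number of 2-color partition triples of `n` whose second color appears only in parts
congruent to `±3 ^ k` modulo `3 ^ (k + 1)`. -/
def pPM (k n : ℕ) : ℕ := Fintype.card (TwoColorTriple k n)

/-! Write `E` for Euler's product, `ζ = q E(q^9)^3 / E(q)^3` (`cubeQuot`), `Y = q E(q^3)^12 /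
E(q)^12` (`hauptmodul`) and `U` for the map `∑ a(n) q^n ↦ ∑ a(3n) q^n` (`trisect`). It satisfies
`U(g(q^3) f) = g U(f)`.

Jacobi's identity gives `E^3 = P(q^3) - 3 q E(q^9)^3`. The product of its conjugates under `q ↦ ωq`,
with `ω` a primitive cube root of unity, determines `P(q^3)^3`. This yields the modular equation
`ζ^3 = Y(q^3) (27 ζ^2 + 9 ζ + 1)` and the values `U(ζ)`, `U(ζ^2)`. By recursion `U((3ζ)^n)` is
`(27Y)^⌈n/3⌉` times an integer polynomial in `27Y` (`exists_trisect_pow`). As `ζ^4 = Y Y(q^3)`, this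
controls `U(Y^m)` and `U(Y^m ζ)`. On series `3^N Y k(9Y)`, the map `U` raises `N` by 2 and `f ↦ U(f
ζ)` raises it by 1.

The generating function is `E^(-3)` times a power series in `q^(3^(2α+1))`. Extracting one residue
class mod 3 at a time applies the two maps alternately (`exists_coeff_eq`, `exists_pPM_eq`), so each
pair of extractions gains `3^3`. This gives the first and third congruences. The second and fourth
gain a further 9 and 3 from the leading term `Y` alone (`nine_dvd_trisect_hauptmodul_mul`,
`three_dvd_trisect_X_mul_hauptmodul_mul`), the remaining terms already carrying a factor 9. -/

open PowerSeries
open scoped PowerSeries.WithPiTopology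

/-! ### Euler's product and the generating function of `pPM` -/

/-- Euler's product `∏ (1 - X ^ n)` over `n ≥ 1`. -/
noncomputable def eulerSeries : ℤ⟦X⟧ := ∏' n : ℕ, (1 - X ^ (n + 1))

lemma hasProd_eulerSeries : HasProd (fun n : ℕ ↦ (1 - X ^ (n + 1) : ℤ⟦X⟧)) eulerSeries :=
  (PowerSeries.WithPiTopology.multipliable_one_sub_X_pow ℤ).hasProd

lemma constantCoeff_eulerSeries : constantCoeff eulerSeries = 1 := by
  have h := hasProd_eulerSeries.map (constantCoeff (R := ℤ))
    (PowerSeries.WithPiTopology.continuous_constantCoeff ℤ)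
  have h1 : ((constantCoeff (R := ℤ)) ∘ fun n : ℕ ↦ (1 - X ^ (n + 1) : ℤ⟦X⟧)) = fun _ ↦ 1 := by
    ext n; simp
  rw [h1] at h
  exact h.unique hasProd_one

/-- The inverse of Euler's product. -/
noncomputable def eulerInv : ℤ⟦X⟧ := invOfUnit eulerSeries 1

lemma eulerSeries_mul_eulerInv : eulerSeries * eulerInv = 1 :=
  mul_invOfUnit _ _ (by simp [constantCoeff_eulerSeries])

lemma continuous_expand {R : Type*} [CommRing R] [TopologicalSpace R] (m : ℕ) (hm : m ≠ 0) :
    Continuous (expand m hm : R⟦X⟧ →ₐ[R] R⟦X⟧) := by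
  rw [continuous_iff_continuousAt]
  intro f
  rw [ContinuousAt, PowerSeries.WithPiTopology.tendsto_iff_coeff_tendsto]
  intro d
  simp_rw [coeff_expand]
  split_ifs
  · exact (PowerSeries.WithPiTopology.continuous_coeff R _).tendsto f
  · exact tendsto_const_nhds

lemma hasProd_expand_eulerSeries (m : ℕ) (hm : m ≠ 0) :
    HasProd (fun n : ℕ ↦ (1 - X ^ (m * (n + 1)) : ℤ⟦X⟧)) (expand m hm eulerSeries) := by
  have h := hasProd_eulerSeries.map (expand m hm : ℤ⟦X⟧ →ₐ[ℤ] ℤ⟦X⟧) (continuous_expand m hm)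
  convert h using 2 with n
  ext n
  simp [pow_mul]

/-- A product over the multiples of `m`, as a product over all positive integers. -/
lemma HasProd.ite_dvd {M : Type*} [CommMonoid M] [TopologicalSpace M] {f : ℕ → M} {a : M} {m : ℕ}
    (hm : m ≠ 0) (h : HasProd (fun n ↦ f (m * (n + 1))) a) :
    HasProd (fun n ↦ if m ∣ n + 1 then f (n + 1) else 1) a := by
  have hpos (n : ℕ) : 0 < m * (n + 1) := Nat.mul_pos (Nat.pos_of_ne_zero hm) n.succ_pos
  have hi : Function.Injective (fun n : ℕ ↦ m * (n + 1) - 1) := by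
    intro x y hxy
    have : m * (x + 1) = m * (y + 1) := by
      have := hpos x; have := hpos y; simp only at hxy; omega
    simpa [hm] using this
  rw [← hi.hasProd_iff]
  · convert h using 2 with n
    simp [Nat.sub_add_cancel (hpos n)]
  · intro x hx
    rw [if_neg]
    rintro ⟨c, hc⟩
    apply hx
    rcases c with _ | c
    · simp at hc
    · exact ⟨c, by simp only; omega⟩

lemma hasProd_ite_dvd_eulerSeries (m : ℕ) (hm : m ≠ 0) :
    HasProd (fun n : ℕ ↦ if m ∣ n + 1 then (1 - X ^ (n + 1) : ℤ⟦X⟧) else 1)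
      (expand m hm eulerSeries) :=
  HasProd.ite_dvd (f := fun k ↦ (1 - X ^ k : ℤ⟦X⟧)) hm (hasProd_expand_eulerSeries m hm)

/-- Each allowed part `n` contributes a geometric series, which cancels the factor `1 - X ^ n` of
`W`. -/
lemma mk_card_restricted_mul (p : ℕ → Prop) [DecidablePred p] {W : ℤ⟦X⟧}
    (hW : HasProd (fun n : ℕ ↦ if p (n + 1) then (1 - X ^ (n + 1) : ℤ⟦X⟧) else 1) W) :
    PowerSeries.mk (fun n ↦ ((Nat.Partition.restricted n p).card : ℤ)) * W = 1 := by
  have h := (Nat.Partition.hasProd_powerSeriesMk_card_restricted ℤ p).mul hW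
  have h1 : (fun b : ℕ ↦ (if p (b + 1) then ∑' j : ℕ, (X ^ ((b + 1) * j) : ℤ⟦X⟧) else 1) *
      if p (b + 1) then 1 - X ^ (b + 1) else 1) = fun _ ↦ 1 := by
    ext1 n
    split_ifs
    · simp_rw [pow_mul]
      exact WithPiTopology.tsum_pow_mul_one_sub_of_constantCoeff_eq_zero (by simp)
    · simp
  rw [h1] at h
  exact h.unique hasProd_one

lemma isPMPow_iff (k m : ℕ) : IsPMPow k m ↔ 3 ^ k ∣ m ∧ ¬ 3 ^ (k + 1) ∣ m := by
  have h3 : (3 : ℤ) ^ k ≠ 0 := by positivity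
  unfold IsPMPow
  rw [Int.modEq_comm, Int.modEq_iff_dvd, Int.modEq_comm (b := -3 ^ k), Int.modEq_iff_dvd,
    ← Int.natCast_dvd_natCast, ← Int.natCast_dvd_natCast]
  push_cast
  have key (r : ℤ) : (3 : ℤ) ^ (k + 1) ∣ 3 ^ k * r ↔ 3 ∣ r := by
    rw [pow_succ, mul_dvd_mul_iff_left h3]
  constructor
  · intro h
    have hd : (3 : ℤ) ^ k ∣ m := by
      have hk : (3 : ℤ) ^ k ∣ 3 ^ (k + 1) := pow_dvd_pow _ (by omega)
      rcases h with h | h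
      · have := (hk.trans h).add (dvd_refl ((3 : ℤ) ^ k)); simpa using this
      · have := (hk.trans h).sub (dvd_refl ((3 : ℤ) ^ k)); simpa using this
    refine ⟨hd, ?_⟩
    obtain ⟨r, hr⟩ := hd
    rw [hr, key]
    rw [hr, show (3 : ℤ) ^ k * r - 3 ^ k = 3 ^ k * (r - 1) by ring,
      show (3 : ℤ) ^ k * r - -3 ^ k = 3 ^ k * (r + 1) by ring, key, key] at h
    omega
  · rintro ⟨⟨r, hr⟩, h⟩
    rw [hr, key] at h
    rw [hr, show (3 : ℤ) ^ k * r - 3 ^ k = 3 ^ k * (r - 1) by ring,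
      show (3 : ℤ) ^ k * r - -3 ^ k = 3 ^ k * (r + 1) by ring, key, key]
    omega

lemma mk_card_restricted_true :
    PowerSeries.mk (fun n ↦ ((Nat.Partition.restricted n (fun _ ↦ True)).card : ℤ)) = eulerInv := by
  have h := mk_card_restricted_mul (fun _ ↦ True) (by simpa using hasProd_eulerSeries)
  linear_combination eulerInv * h - PowerSeries.mk (fun n ↦
    ((Nat.Partition.restricted n (fun _ ↦ True)).card : ℤ)) * eulerSeries_mul_eulerInv

lemma mk_card_restricted_isPMPow (k : ℕ) :
    PowerSeries.mk (fun n ↦ ((Nat.Partition.restricted n (IsPMPow k)).card : ℤ)) =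
      expand (3 ^ k) (by positivity) (expand 3 (by norm_num) eulerSeries * eulerInv) := by
  have hm : Multipliable
      (fun n : ℕ ↦ if IsPMPow k (n + 1) then (1 - X ^ (n + 1) : ℤ⟦X⟧) else 1) := by
    have h (n : ℕ) : (if IsPMPow k (n + 1) then (1 - X ^ (n + 1) : ℤ⟦X⟧) else 1) =
        1 + if IsPMPow k (n + 1) then - X ^ (n + 1) else 0 := by
      split_ifs <;> ring
    simp_rw [h]
    apply PowerSeries.WithPiTopology.multipliable_one_add_of_tendsto_order_atTop_nhds_top
    refine ENat.tendsto_nhds_top_iff_natCast_lt.mpr fun n ↦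
      Filter.eventually_atTop.mpr ⟨n, fun m hm ↦ ?_⟩
    split_ifs
    · rw [order_neg, order_X_pow]
      exact_mod_cast Nat.lt_add_one_iff.mpr hm
    · simp
  obtain ⟨W, hW⟩ := hm
  have h1 := mk_card_restricted_mul (IsPMPow k) hW
  have h2 := hW.mul (hasProd_ite_dvd_eulerSeries (3 ^ (k + 1)) (by positivity))
  have h3 : W * expand (3 ^ (k + 1)) (by positivity) eulerSeries =
      expand (3 ^ k) (by positivity) eulerSeries := by
    -- The multiples of `3 ^ k` are the allowed parts together with the multiples of `3 ^ (k + 1)`.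
    refine h2.unique ?_
    convert hasProd_ite_dvd_eulerSeries (3 ^ k) (by positivity) using 2 with n
    have hiff := isPMPow_iff k (n + 1)
    by_cases ha : 3 ^ (k + 1) ∣ n + 1
    · have : 3 ^ k ∣ n + 1 := (pow_dvd_pow _ (by omega)).trans ha
      simp only [hiff, ha, this, not_true, and_false, if_true, if_false, one_mul]
    · simp only [hiff, ha, not_false_eq_true, and_true, if_false, mul_one]
  have h4 : expand (3 ^ k) (by positivity) (expand 3 (by norm_num) eulerSeries) =
      expand (3 ^ (k + 1)) (by positivity) eulerSeries := by
    rw [← expand_mul]; rfl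
  have h5 := congrArg (expand (3 ^ k) (by positivity)) eulerSeries_mul_eulerInv
  rw [map_mul, map_one] at h5
  rw [map_mul, h4]
  linear_combination (-expand (3 ^ k) (by positivity) eulerInv * PowerSeries.mk (fun n ↦ ((Nat.Partition.restricted n (IsPMPow k)).card : ℤ))) * h3
    + expand (3 ^ k) (by positivity) eulerInv * expand (3 ^ (k + 1)) (by positivity) eulerSeries * h1 - PowerSeries.mk (fun n ↦ ((Nat.Partition.restricted n (IsPMPow k)).card : ℤ)) * h5

lemma pPM_eq_sum (k n : ℕ) : pPM k n = ∑ a ∈ Finset.piAntidiag (Finset.univ : Finset (Fin 2 × Fin 3)) n,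
    ∏ j, (Nat.Partition.restricted (a j) (fun m ↦ j.1 = 1 → IsPMPow k m)).card := by
  rw [pPM]
  unfold TwoColorTriple
  rw [Fintype.card_sigma, Finset.univ_eq_attach, ← Finset.sum_attach (Finset.piAntidiag _ _)]
  refine Finset.sum_congr rfl fun a _ ↦ ?_
  rw [Fintype.card_pi]
  refine Finset.prod_congr rfl fun j _ ↦ ?_
  rw [Fintype.card_subtype, Nat.Partition.restricted]
  congr 1
  ext P
  simp only [Finset.mem_filter, Finset.mem_univ, true_and]
  exact ⟨fun h m hm hj ↦ h hj m hm, fun h hj m hm ↦ h m hm hj⟩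

/-- The generating function of `pPM k`. -/
lemma mk_pPM (k : ℕ) : PowerSeries.mk (fun n ↦ (pPM k n : ℤ)) =
    eulerInv ^ 3 * expand (3 ^ k) (by positivity) ((expand 3 (by norm_num) eulerSeries * eulerInv) ^ 3) := by
  have h : PowerSeries.mk (fun n ↦ (pPM k n : ℤ)) = ∏ j : Fin 2 × Fin 3,
      PowerSeries.mk (fun n ↦
        ((Nat.Partition.restricted n (fun m ↦ j.1 = 1 → IsPMPow k m)).card : ℤ)) := by
    ext n
    rw [coeff_mk, coeff_prod, pPM_eq_sum]
    push_cast
    refine Finset.sum_nbij' (fun a ↦ Finsupp.equivFunOnFinite.symm a) (fun l ↦ ⇑l) ?_ ?_ ?_ ?_ ?_ <;>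
      simp
  rw [h, Fintype.prod_prod_type]
  simp only [Fin.prod_univ_two, Finset.prod_const, Finset.card_univ, Fintype.card_fin]
  simp [mk_card_restricted_isPMPow, mk_card_restricted_true]

/-! ### Conjugates of Euler's product under cube roots of unity -/

lemma continuous_map_castInt : Continuous (PowerSeries.map (Int.castRingHom ℂ)) := by
  rw [continuous_iff_continuousAt]
  intro f
  rw [ContinuousAt, PowerSeries.WithPiTopology.tendsto_iff_coeff_tendsto]
  intro d
  simp_rw [coeff_map]
  exact ((continuous_of_discreteTopology (f := (Int.castRingHom ℂ))).comp
    (PowerSeries.WithPiTopology.continuous_coeff ℤ d)).tendsto f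

lemma continuous_rescale (a : ℂ) : Continuous (rescale a) := by
  rw [continuous_iff_continuousAt]
  intro f
  rw [ContinuousAt, PowerSeries.WithPiTopology.tendsto_iff_coeff_tendsto]
  intro d
  simp_rw [coeff_rescale]
  exact ((PowerSeries.WithPiTopology.continuous_coeff ℂ d).const_mul (a ^ d)).tendsto f

lemma rescale_expand_three {ω : ℂ} (hω : ω ^ 3 = 1) (f : ℂ⟦X⟧) :
    rescale ω (expand 3 (by norm_num) f) = expand 3 (by norm_num) f := by
  ext n
  rw [coeff_rescale, coeff_expand]
  split_ifs with h
  · obtain ⟨k, rfl⟩ := h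
    rw [pow_mul, hω, one_pow, one_mul]
  · simp

lemma hasProd_rescale_eulerSeries (a : ℂ) :
    HasProd (fun n : ℕ ↦ (1 - C (a ^ (n + 1)) * X ^ (n + 1) : ℂ⟦X⟧))
      (rescale a (PowerSeries.map (Int.castRingHom ℂ) eulerSeries)) := by
  have h := (hasProd_eulerSeries.map _ continuous_map_castInt).map _ (continuous_rescale a)
  convert h using 2 with n
  ext n
  simp [rescale_X, mul_pow]

/-- The norm of Euler's product from `ℂ⟦X⟧` to `ℂ⟦X ^ 3⟧`. -/
lemma norm_eulerSeries {ω : ℂ} (hω : 1 + ω + ω ^ 2 = 0) :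
    PowerSeries.map (Int.castRingHom ℂ) eulerSeries *
      rescale ω (PowerSeries.map (Int.castRingHom ℂ) eulerSeries) *
      rescale (ω ^ 2) (PowerSeries.map (Int.castRingHom ℂ) eulerSeries) *
      PowerSeries.map (Int.castRingHom ℂ) (expand 9 (by norm_num) eulerSeries) =
    PowerSeries.map (Int.castRingHom ℂ) (expand 3 (by norm_num) eulerSeries) ^ 4 := by
  have h3 : ω ^ 3 = 1 := by linear_combination (ω - 1) * hω
  have hE := hasProd_eulerSeries.map _ continuous_map_castInt
  have h9 : HasProd (fun n : ℕ ↦ if 3 ∣ n + 1 then (1 - X ^ (3 * (n + 1)) : ℤ⟦X⟧) else 1)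
      (expand 9 (by norm_num) eulerSeries) := by
    refine HasProd.ite_dvd (f := fun k ↦ (1 - X ^ (3 * k) : ℤ⟦X⟧)) (by norm_num) ?_
    simp_rw [← mul_assoc]
    exact hasProd_expand_eulerSeries 9 (by norm_num)
  have h9c := h9.map _ continuous_map_castInt
  have hl := ((hE.mul (hasProd_rescale_eulerSeries ω)).mul
    (hasProd_rescale_eulerSeries (ω ^ 2))).mul h9c
  have hk := hasProd_ite_dvd_eulerSeries 3 (by norm_num)
  have hr := ((hasProd_expand_eulerSeries 3 (by norm_num)).mul
    ((hk.mul hk).mul hk)).map _ continuous_map_castInt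
  rw [← map_pow]
  refine hl.unique ?_
  rw [show expand 3 (by norm_num) eulerSeries ^ 4 = expand 3 (by norm_num) eulerSeries *
    (expand 3 (by norm_num) eulerSeries * expand 3 (by norm_num) eulerSeries *
      expand 3 (by norm_num) eulerSeries) by ring]
  convert hr using 1
  ext1 n
  simp only [Function.comp_apply, map_mul, map_sub, map_one, map_pow, map_X, apply_ite
    (PowerSeries.map (Int.castRingHom ℂ))]
  -- If `3 ∣ n + 1`, the three conjugate factors coincide; otherwise they multiply to `1 - X ^ (3 *
  -- (n + 1))`.
  split_ifs with h
  · obtain ⟨k, hk⟩ := h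
    have hC3 : (C ω : ℂ⟦X⟧) ^ 3 = 1 := by rw [← map_pow, h3, map_one]
    rw [hk, ← pow_mul, mul_comm 2, mul_assoc 3 k 2, pow_mul (C ω), pow_mul (C ω), hC3]
    simp
    ring
  · have hC : (1 : ℂ⟦X⟧) + C (ω ^ (n + 1)) + C ((ω ^ 2) ^ (n + 1)) = 0 := by
      rw [← map_one C, ← map_add, ← map_add, ← map_zero C]
      congr 1
      obtain ⟨k, hk⟩ : ∃ k, n + 1 = 3 * k + 1 ∨ n + 1 = 3 * k + 2 := ⟨(n + 1) / 3, by omega⟩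
      rcases hk with hk | hk <;> rw [hk, ← pow_mul, mul_comm 2, pow_mul, pow_add, pow_mul, h3] <;>
        simp
      · linear_combination hω
      · linear_combination hω + ω * h3
    have hC1 : (C (ω ^ (n + 1)) * C ((ω ^ 2) ^ (n + 1)) : ℂ⟦X⟧) = 1 := by
      rw [← map_mul, ← mul_pow, show ω * ω ^ 2 = ω ^ 3 by ring, h3]
      simp
    simp only [map_pow] at hC hC1
    rw [pow_mul', mul_one, mul_one, mul_one, mul_one]
    linear_combination (-(X : ℂ⟦X⟧) ^ (n + 1) + (X ^ (n + 1)) ^ 2) * hC +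
      ((X ^ (n + 1)) ^ 2 - (X ^ (n + 1)) ^ 3) * hC1

/-! ### The `q`-binomial theorem and a finite Jacobi identity -/

section Rothe
variable {A : Type*} [CommRing A]

/-- The `q`-binomial theorem, with the `q`-binomial coefficient written as a quotient of
`q`-factorials `Q n = ∏ (1 - q ^ i)` with inverses `I n`. -/
lemma prod_add_mul_pow_eq_sum {q : A} {Q I : ℕ → A} (hQ0 : Q 0 = 1)
    (hQ : ∀ n, Q (n + 1) = Q n * (1 - q ^ (n + 1))) (hQI : ∀ n, Q n * I n = 1) (n : ℕ) (y z : A) :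
    ∏ j ∈ Finset.range n, (y + z * q ^ j) =
      Q n * ∑ p ∈ Finset.HasAntidiagonal.antidiagonal n, q ^ p.1.choose 2 * I p.1 * I p.2 * z ^ p.1 * y ^ p.2 := by
  have hI0 : I 0 = 1 := by simpa [hQ0] using hQI 0
  have hI (n : ℕ) : (1 - q ^ (n + 1)) * I (n + 1) = I n := by
    have h1 := hQI n
    have h2 := hQI (n + 1)
    rw [hQ] at h2
    linear_combination I n * h2 - (1 - q ^ (n + 1)) * I (n + 1) * h1
  induction n generalizing z with
  | zero => simp [hQ0, hI0]
  | succ n ih =>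
    have hz (j : ℕ) : z * q ^ (j + 1) = z * q * q ^ j := by ring
    rw [Finset.prod_range_succ']
    simp_rw [hz]
    rw [ih, hQ, mul_assoc, mul_assoc]
    congr 1
    have h1 : (1 - q ^ (n + 1)) * ∑ p ∈ Finset.HasAntidiagonal.antidiagonal (n + 1),
          q ^ p.1.choose 2 * I p.1 * I p.2 * z ^ p.1 * y ^ p.2 =
        ∑ p ∈ Finset.HasAntidiagonal.antidiagonal (n + 1),
          q ^ p.1.choose 2 * q ^ p.1 * I p.1 * ((1 - q ^ p.2) * I p.2) * z ^ p.1 * y ^ p.2 +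
        ∑ p ∈ Finset.HasAntidiagonal.antidiagonal (n + 1),
          q ^ p.1.choose 2 * ((1 - q ^ p.1) * I p.1) * I p.2 * z ^ p.1 * y ^ p.2 := by
      rw [Finset.mul_sum, ← Finset.sum_add_distrib]
      refine Finset.sum_congr rfl fun p hp ↦ ?_
      rw [← Finset.HasAntidiagonal.mem_antidiagonal.mp hp, pow_add]
      ring
    rw [h1, Finset.Nat.sum_antidiagonal_succ', Finset.Nat.sum_antidiagonal_succ]
    simp only [hI, pow_zero, sub_self, zero_mul, mul_zero, zero_add]
    rw [Finset.sum_mul, ← Finset.sum_add_distrib]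
    refine Finset.sum_congr rfl fun p _ ↦ ?_
    rw [show (p.1 + 1).choose 2 = p.1 + p.1.choose 2 by simp [Nat.choose_succ_succ]]
    ring

lemma prod_pow_sub_pow {q : A} {Q : ℕ → A} (hQ0 : Q 0 = 1)
    (hQ : ∀ n, Q (n + 1) = Q n * (1 - q ^ (n + 1))) (n : ℕ) :
    ∏ j ∈ Finset.range n, (q ^ n - q ^ j) = (-1) ^ n * q ^ n.choose 2 * Q n := by
  induction n with
  | zero => simp [hQ0]
  | succ n ih =>
    have h (j : ℕ) : q ^ (n + 1) - q ^ (j + 1) = q * (q ^ n - q ^ j) := by ring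
    rw [Finset.prod_range_succ']
    simp_rw [h]
    rw [Finset.prod_mul_distrib, ih, hQ, Finset.prod_const, Finset.card_range,
      show (n + 1).choose 2 = n + n.choose 2 by simp [Nat.choose_succ_succ]]
    ring

lemma prod_one_sub_pow_succ {q : A} {Q : ℕ → A} (hQ0 : Q 0 = 1)
    (hQ : ∀ n, Q (n + 1) = Q n * (1 - q ^ (n + 1))) (n : ℕ) :
    ∏ j ∈ Finset.range n, (1 - q ^ (j + 1)) = Q n := by
  induction n with
  | zero => simp [hQ0]
  | succ n ih => rw [Finset.prod_range_succ, ih, hQ]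

lemma two_mul_choose_two (n : ℕ) : (2 * n.choose 2 : ℤ) = n ^ 2 - n := by
  induction n with
  | zero => simp
  | succ n ih =>
    rw [show (n + 1).choose 2 = n + n.choose 2 by simp [Nat.choose_succ_succ]]
    push_cast
    linear_combination ih

/-- In the `q`-binomial sum of length `2N + 1` with `N = r + m`, the terms of index `N - m` and `N +
1 + m` carry the same power of `q`: a constant depending on `N` plus the triangular number of `m`.
This and the next lemma compute the two exponents. -/
lemma choose_two_exponent_left (m r : ℕ) :
    r.choose 2 + (r + m) * (r + 2 * m + 1) =
      ((r + m) ^ 2 + (r + m).choose 2 + (r + m)) + (m + 1).choose 2 := by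
  have h1 := two_mul_choose_two r
  have h2 := two_mul_choose_two (r + m)
  have h3 := two_mul_choose_two (m + 1)
  push_cast at h1 h2 h3
  refine Nat.eq_of_mul_eq_mul_left two_pos ?_
  zify
  linear_combination h1 - h2 - h3

lemma choose_two_exponent_right (m r : ℕ) :
    (r + 2 * m + 1).choose 2 + (r + m) * r =
      ((r + m) ^ 2 + (r + m).choose 2 + (r + m)) + (m + 1).choose 2 := by
  have h1 := two_mul_choose_two (r + 2 * m + 1)
  have h2 := two_mul_choose_two (r + m)
  have h3 := two_mul_choose_two (m + 1)
  push_cast at h1 h2 h3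
  refine Nat.eq_of_mul_eq_mul_left two_pos ?_
  zify
  linear_combination h1 - h2 - h3

/-- A finite form of Jacobi's identity for the cube of Euler's product, obtained by
differentiating the `q`-binomial theorem at a root. -/
lemma finite_jacobi [IsDomain A] {q : A} (hq : q ≠ 0) {Q I : ℕ → A} (hQ0 : Q 0 = 1)
    (hQ : ∀ n, Q (n + 1) = Q n * (1 - q ^ (n + 1))) (hQI : ∀ n, Q n * I n = 1) (N : ℕ) :
    Q N ^ 2 = Q (2 * N + 1) * ∑ m ∈ Finset.range (N + 1),
      (-1) ^ m * (2 * m + 1) * q ^ (m + 1).choose 2 * I (N - m) * I (N + 1 + m) := by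
  -- The product is `∏ (q ^ N - X q ^ j)` over `j ≤ 2N`. Its factor `j = N` vanishes at `X = 1`, so
  -- the derivative there is the product of the other factors, up to `-q ^ N`.
  have h := prod_add_mul_pow_eq_sum (A := Polynomial A) (q := Polynomial.C q)
    (Q := fun n ↦ Polynomial.C (Q n)) (I := fun n ↦ Polynomial.C (I n)) (by simp [hQ0])
    (by simp [hQ]) (fun n ↦ by rw [← map_mul, hQI, map_one]) (N + (N + 1))
    (Polynomial.C (q ^ N)) (-Polynomial.X)
  rw [Finset.prod_range_add, Finset.prod_range_succ' _ N, ← mul_assoc, add_zero,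
    show Polynomial.C (q ^ N) + -Polynomial.X * Polynomial.C q ^ N =
      Polynomial.C (q ^ N) * (1 - Polynomial.X) by rw [map_pow]; ring, ← mul_assoc] at h
  have hterm (p : ℕ × ℕ) : Polynomial.C q ^ p.1.choose 2 * Polynomial.C (I p.1) *
      Polynomial.C (I p.2) * (-Polynomial.X) ^ p.1 * Polynomial.C (q ^ N) ^ p.2 =
      Polynomial.C (q ^ p.1.choose 2 * I p.1 * I p.2 * (-1) ^ p.1 * (q ^ N) ^ p.2) *
        Polynomial.X ^ p.1 := by
    rw [neg_pow]
    simp only [map_mul, map_pow, map_neg, map_one]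
    ring
  simp_rw [hterm] at h
  have h' := congrArg (fun p ↦ Polynomial.eval 1 (Polynomial.derivative p)) h
  rw [Polynomial.derivative_mul, Polynomial.derivative_C_mul, Polynomial.derivative_sum] at h'
  simp only [Polynomial.derivative_C_mul, Polynomial.derivative_X_pow, Polynomial.derivative_sub,
    Polynomial.derivative_one, Polynomial.derivative_X, Polynomial.eval_add,
    Polynomial.eval_sub, Polynomial.eval_mul, Polynomial.eval_finsetSum, Polynomial.eval_prod,
    Polynomial.eval_C, Polynomial.eval_X, Polynomial.eval_pow, Polynomial.eval_one,
    Polynomial.eval_neg, one_pow, mul_one, sub_self, mul_zero,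
    zero_add, neg_one_mul, zero_sub, ← sub_eq_add_neg] at h'
  rw [prod_pow_sub_pow hQ0 hQ] at h'
  have hB : ∏ x ∈ Finset.range N, (q ^ N - q ^ (N + (x + 1))) = (q ^ N) ^ N * Q N := by
    have hx (x : ℕ) : q ^ N - q ^ (N + (x + 1)) = q ^ N * (1 - q ^ (x + 1)) := by ring
    simp_rw [hx]
    rw [Finset.prod_mul_distrib, prod_one_sub_pow_succ hQ0 hQ, Finset.prod_const,
      Finset.card_range]
  -- Reflecting the lower half of the sum pairs index `N - m` with `N + 1 + m`; the derivative
  -- weights then combine to `2m + 1`.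
  rw [hB, Finset.Nat.sum_antidiagonal_eq_sum_range_succ_mk,
    show (N + (N + 1)).succ = (N + 1) + (N + 1) by omega, Finset.sum_range_add,
    ← Finset.sum_range_reflect, ← Finset.sum_add_distrib] at h'
  have hc : (-1) ^ (N + 1) * q ^ (N ^ 2 + N.choose 2 + N) ≠ 0 := by
    simp [hq]
  refine mul_left_cancel₀ hc ?_
  rw [show 2 * N + 1 = N + (N + 1) by ring, mul_left_comm, Finset.mul_sum]
  have hl : (-1) ^ (N + 1) * q ^ (N ^ 2 + N.choose 2 + N) * Q N ^ 2 =
      (-1) ^ N * q ^ N.choose 2 * Q N * ((q ^ N) ^ N * Q N) * q ^ N * -1 := by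
    ring
  rw [hl]
  refine Eq.trans ?_ (h'.trans ?_)
  · ring
  congr 1
  refine Finset.sum_congr rfl fun m hm ↦ ?_
  obtain ⟨r, rfl⟩ : ∃ r, N = r + m := ⟨N - m, by have := Finset.mem_range.mp hm; omega⟩
  have e1 : r + m + 1 - 1 - m = r := by omega
  have e2 : r + m + (r + m + 1) - r = r + 2 * m + 1 := by omega
  have e3 : r + m + (r + m + 1) - (r + 2 * m + 1) = r := by omega
  have e4 : r + m + 1 + m = r + 2 * m + 1 := by omega
  have e5 : r + m - m = r := by omega
  simp only [e1, e2, e3, e4, e5]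
  have hL := congrArg (q ^ ·) (choose_two_exponent_left m r)
  have hR := congrArg (q ^ ·) (choose_two_exponent_right m r)
  simp only [pow_add _ (r.choose 2), pow_add _ _ ((r + m) * r), pow_mul _ (r + m),
    pow_add _ _ ((m + 1).choose 2)] at hL hR
  have hs : ((-1 : A)) ^ (r + 2 * m + 1) = - (-1) ^ r := by
    rw [pow_succ, pow_add, pow_mul]; simp
  have hs' : ((-1 : A)) ^ (r + m + 1) * (-1) ^ m = - (-1) ^ r := by
    rw [← pow_add, e4, hs]
  rw [hs]
  push_cast
  linear_combination (I r * I (r + 2 * m + 1) * (-1) ^ r * r) * hL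
    - (I r * I (r + 2 * m + 1) * (-1) ^ r * (r + 2 * m + 1)) * hR
    - (q ^ ((r + m) ^ 2 + (r + m).choose 2 + (r + m)) * q ^ (m + 1).choose 2 * (2 * m + 1) * I r * I (r + 2 * m + 1)) * hs'
end Rothe

/-! ### Passage to the limit in Jacobi's identity -/

/-- The partial products of `eulerSeries`. -/
noncomputable def eulerPartial (n : ℕ) : ℤ⟦X⟧ := ∏ i ∈ Finset.range n, (1 - X ^ (i + 1))

lemma eulerPartial_succ (n : ℕ) :
    eulerPartial (n + 1) = eulerPartial n * (1 - X ^ (n + 1)) := Finset.prod_range_succ _ _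

lemma X_pow_dvd_eulerPartial_sub {n N : ℕ} (h : n ≤ N) :
    (X : ℤ⟦X⟧) ^ (n + 1) ∣ eulerPartial N - eulerPartial n := by
  induction N, h using Nat.le_induction with
  | base => simp
  | succ N hN ih =>
    rw [eulerPartial_succ, show eulerPartial N * (1 - X ^ (N + 1)) - eulerPartial n =
      (eulerPartial N - eulerPartial n) - eulerPartial N * X ^ (N + 1) by ring]
    exact ih.sub ((pow_dvd_pow _ (by omega)).mul_left _)

lemma X_pow_dvd_eulerSeries_sub (n : ℕ) :
    (X : ℤ⟦X⟧) ^ (n + 1) ∣ eulerSeries - eulerPartial n := by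
  rw [X_pow_dvd_iff]
  intro d hd
  have h := (PowerSeries.WithPiTopology.tendsto_iff_coeff_tendsto ℤ _ _ _).mp
    hasProd_eulerSeries.tendsto_prod_nat d
  rw [nhds_discrete, Filter.tendsto_pure, Filter.eventually_atTop] at h
  obtain ⟨N, hN⟩ := h
  have h1 := hN (max N n) (le_max_left _ _)
  have h2 := X_pow_dvd_iff.mp (X_pow_dvd_eulerPartial_sub (le_max_right N n)) d hd
  rw [map_sub] at h2 ⊢
  rw [← h1]
  exact h2

/-- The inverses of the partial products of `eulerSeries`. -/
noncomputable def eulerPartialInv (n : ℕ) : ℤ⟦X⟧ := invOfUnit (eulerPartial n) 1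

lemma eulerPartial_mul_inv (n : ℕ) : eulerPartial n * eulerPartialInv n = 1 :=
  mul_invOfUnit _ _ (by simp [eulerPartial])

lemma X_pow_dvd_eulerInv_sub (n : ℕ) :
    (X : ℤ⟦X⟧) ^ (n + 1) ∣ eulerPartialInv n - eulerInv := by
  have h : eulerPartialInv n - eulerInv =
      (eulerSeries - eulerPartial n) * (eulerPartialInv n * eulerInv) := by
    linear_combination -eulerPartialInv n * eulerSeries_mul_eulerInv +
      eulerInv * eulerPartial_mul_inv n
  rw [h]
  exact (X_pow_dvd_eulerSeries_sub n).mul_right _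

/-- **Jacobi's identity** `E ^ 3 = ∑ (-1) ^ m * (2 * m + 1) * X ^ (m * (m + 1) / 2)`, modulo
`X ^ N`. -/
lemma X_pow_dvd_eulerSeries_pow_three_sub (N : ℕ) :
    (X : ℤ⟦X⟧) ^ N ∣ eulerSeries ^ 3 -
      ∑ m ∈ Finset.range N, (-1) ^ m * (2 * (m : ℤ⟦X⟧) + 1) * X ^ (m + 1).choose 2 := by
  rcases N with _ | N
  · simp
  have h := finite_jacobi (q := (X : ℤ⟦X⟧)) X_ne_zero (Q := eulerPartial) (I := eulerPartialInv)
    (by simp [eulerPartial]) eulerPartial_succ eulerPartial_mul_inv N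
  have hm : (X : ℤ⟦X⟧) ^ (N + 1) ∣ eulerPartial N ^ 2 - eulerInv *
      ∑ m ∈ Finset.range (N + 1), (-1) ^ m * (2 * (m : ℤ⟦X⟧) + 1) * X ^ (m + 1).choose 2 := by
    rw [h, Finset.mul_sum, Finset.mul_sum, ← Finset.sum_sub_distrib]
    refine Finset.dvd_sum fun m hm ↦ ?_
    have hmN : m ≤ N := by have := Finset.mem_range.mp hm; omega
    -- The triangular exponent is at least `m`, so the other factors of term `m` are needed only
    -- modulo `X ^ (N - m + 1)`.
    have hX : (X : ℤ⟦X⟧) ^ (N + 1) ∣ X ^ (m + 1).choose 2 * X ^ (N - m + 1) := by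
      rw [← pow_add]
      refine pow_dvd_pow _ ?_
      rw [show (m + 1).choose 2 = m + m.choose 2 by simp [Nat.choose_succ_succ]]
      omega
    have h1 : (X : ℤ⟦X⟧) ^ (N - m + 1) ∣
        eulerPartial (2 * N + 1) * eulerPartialInv (N - m) * eulerPartialInv (N + 1 + m)
          - eulerInv := by
      have e1 : (X : ℤ⟦X⟧) ^ (N - m + 1) ∣ eulerSeries - eulerPartial (2 * N + 1) :=
        (pow_dvd_pow _ (by omega)).trans (X_pow_dvd_eulerSeries_sub _)
      have e2 : (X : ℤ⟦X⟧) ^ (N - m + 1) ∣ eulerPartialInv (N - m) - eulerInv :=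
        (pow_dvd_pow _ (by omega)).trans (X_pow_dvd_eulerInv_sub _)
      have e3 : (X : ℤ⟦X⟧) ^ (N - m + 1) ∣ eulerPartialInv (N + 1 + m) - eulerInv :=
        (pow_dvd_pow _ (by omega)).trans (X_pow_dvd_eulerInv_sub _)
      have e : eulerPartial (2 * N + 1) * eulerPartialInv (N - m) * eulerPartialInv (N + 1 + m)
          - eulerInv = (eulerPartialInv (N - m) - eulerInv) *
            (eulerSeries * eulerPartialInv (N + 1 + m)) +
          (eulerPartialInv (N + 1 + m) - eulerInv) * (eulerSeries * eulerInv) -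
          (eulerSeries - eulerPartial (2 * N + 1)) *
            (eulerPartialInv (N - m) * eulerPartialInv (N + 1 + m)) := by
        linear_combination eulerInv * eulerSeries_mul_eulerInv
      rw [e]
      exact ((e2.mul_right _).add (e3.mul_right _)).sub (e1.mul_right _)
    have e : eulerPartial (2 * N + 1) * ((-1) ^ m * (2 * (m : ℤ⟦X⟧) + 1) * X ^ (m + 1).choose 2 *
          eulerPartialInv (N - m) * eulerPartialInv (N + 1 + m)) -
        eulerInv * ((-1) ^ m * (2 * (m : ℤ⟦X⟧) + 1) * X ^ (m + 1).choose 2) =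
        (-1) ^ m * (2 * (m : ℤ⟦X⟧) + 1) * (X ^ (m + 1).choose 2 * (eulerPartial (2 * N + 1) *
          eulerPartialInv (N - m) * eulerPartialInv (N + 1 + m) - eulerInv)) := by ring
    rw [e]
    exact (hX.trans (mul_dvd_mul_left _ h1)).mul_left _
  have e (S : ℤ⟦X⟧) : eulerSeries ^ 3 - S = eulerSeries * (eulerPartial N ^ 2 - eulerInv * S) +
      (eulerSeries - eulerPartial N) * (eulerSeries * (eulerSeries + eulerPartial N)) := by
    linear_combination S * eulerSeries_mul_eulerInv
  rw [e]
  exact (hm.mul_left _).add ((X_pow_dvd_eulerSeries_sub N).mul_right _)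

/-! ### The 3-dissection of the cube of Euler's product -/

lemma sum_range_three_mul {M : Type*} [AddCommMonoid M] (g : ℕ → M) (N : ℕ) :
    ∑ m ∈ Finset.range (3 * N), g m =
      ∑ k ∈ Finset.range N, (g (3 * k) + g (3 * k + 1) + g (3 * k + 2)) := by
  induction N with
  | zero => simp
  | succ N ih =>
    rw [show 3 * (N + 1) = 3 * N + 1 + 1 + 1 by ring, Finset.sum_range_succ, Finset.sum_range_succ,
      Finset.sum_range_succ, ih, Finset.sum_range_succ]
    simp only [add_assoc]

lemma exists_eq_expand (m : ℕ) (hm : m ≠ 0) (f : ℤ⟦X⟧) (h : ∀ n, ¬ m ∣ n → coeff n f = 0) :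
    ∃ g, f = expand m hm g := by
  refine ⟨PowerSeries.mk fun n ↦ coeff (m * n) f, ?_⟩
  ext n
  rw [coeff_expand]
  split_ifs with hn
  · rw [coeff_mk, Nat.mul_div_cancel' hn]
  · exact h n hn

/-- The 3-dissection of the cube of Euler's product. -/
lemma exists_eulerSeries_pow_three_eq : ∃ P : ℤ⟦X⟧, eulerSeries ^ 3 =
    expand 3 (by norm_num) P - 3 * (X * expand 9 (by norm_num) eulerSeries ^ 3) := by
  suffices h : ∀ n, ¬ 3 ∣ n →
      coeff n (eulerSeries ^ 3 + 3 * (X * expand 9 (by norm_num) eulerSeries ^ 3)) = 0 by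
    obtain ⟨P, hP⟩ := exists_eq_expand 3 (by norm_num) _ h
    exact ⟨P, eq_sub_of_add_eq hP⟩
  intro n hn
  set g : ℕ → ℤ⟦X⟧ := fun m ↦ (-1) ^ m * (2 * (m : ℤ⟦X⟧) + 1) * X ^ (m + 1).choose 2 with hg
  have hJ (N : ℕ) : (X : ℤ⟦X⟧) ^ N ∣ eulerSeries ^ 3 - ∑ m ∈ Finset.range N, g m :=
    X_pow_dvd_eulerSeries_pow_three_sub N
  have h1 := hJ (3 * (n + 1))
  obtain ⟨c, hc⟩ := hJ (n + 1)
  have h2 := congrArg (expand 9 (by norm_num)) hc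
  rw [map_mul, map_sub, map_pow, map_pow, expand_X, map_sum] at h2
  -- Triangular numbers are divisible by 3 except at indices `3k + 1`, where the value is 1 plus 9
  -- times the `k`-th one. There `2m + 1 = 3(2k + 1)` and the sign flips, so these terms reproduce
  -- Jacobi's series in `X ^ 9`.
  have hmid (k : ℕ) : g (3 * k + 1) = -(3 * (X * expand 9 (by norm_num) (g k))) := by
    have hch : (3 * k + 1 + 1).choose 2 = 1 + 9 * (k + 1).choose 2 := by
      have e1 := two_mul_choose_two (3 * k + 1 + 1)
      have e2 := two_mul_choose_two (k + 1)
      push_cast at e1 e2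
      refine Nat.eq_of_mul_eq_mul_left two_pos ?_
      zify
      linear_combination e1 - 9 * e2
    have hs : ((-1 : ℤ⟦X⟧)) ^ (3 * k + 1) = - (-1) ^ k := by
      rw [pow_succ, pow_mul]; norm_num
    simp only [hg, hch, hs, map_mul, map_pow, map_neg, map_one, map_add, map_ofNat, map_natCast,
      expand_X]
    push_cast
    ring
  rw [sum_range_three_mul] at h1
  have h3 : (X : ℤ⟦X⟧) ^ (n + 1) ∣ eulerSeries ^ 3 +
      3 * (X * expand 9 (by norm_num) eulerSeries ^ 3) -
      ∑ k ∈ Finset.range (n + 1), (g (3 * k) + g (3 * k + 2)) := by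
    have e : eulerSeries ^ 3 + 3 * (X * expand 9 (by norm_num) eulerSeries ^ 3) -
        ∑ k ∈ Finset.range (n + 1), (g (3 * k) + g (3 * k + 2)) =
        (eulerSeries ^ 3 - ∑ k ∈ Finset.range (n + 1), (g (3 * k) + g (3 * k + 1) + g (3 * k + 2)))
        + 3 * X * (expand 9 (by norm_num) eulerSeries ^ 3 -
          ∑ k ∈ Finset.range (n + 1), expand 9 (by norm_num) (g k)) := by
      simp_rw [hmid, Finset.sum_add_distrib, Finset.sum_neg_distrib, ← Finset.mul_sum]
      ring
    rw [e]
    refine ((pow_dvd_pow X (by omega : n + 1 ≤ 3 * (n + 1))).trans h1).add (Dvd.dvd.mul_left ?_ _)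
    rw [h2, ← pow_mul]
    exact (pow_dvd_pow X (by omega : n + 1 ≤ 9 * (n + 1))).mul_right _
  have h4 := X_pow_dvd_iff.mp h3 n (by omega)
  rw [map_sub, sub_eq_zero] at h4
  rw [h4, map_sum]
  refine Finset.sum_eq_zero fun k _ ↦ ?_
  have hz (m : ℕ) (hm : 3 ∣ (m + 1).choose 2) : coeff n (g m) = 0 := by
    have : g m = C ((-1) ^ m * (2 * (m : ℤ) + 1)) * X ^ (m + 1).choose 2 := by simp [hg]
    rw [this, coeff_C_mul, coeff_X_pow, if_neg, mul_zero]
    rintro rfl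
    exact hn hm
  rw [map_add, hz, hz, add_zero]
  · have e := two_mul_choose_two (3 * k + 2 + 1)
    have : (2 * (3 * k + 2 + 1).choose 2 : ℤ) = 3 * ((k + 1) * (3 * k + 2)) := by
      rw [e]; push_cast; ring
    omega
  · have e := two_mul_choose_two (3 * k + 1)
    have : (2 * (3 * k + 1).choose 2 : ℤ) = 3 * (k * (3 * k + 1)) := by
      rw [e]; push_cast; ring
    omega

/-- The cubed norm identity for the 3-dissection of the cube of Euler's product. -/
lemma dissection_norm {P : ℤ⟦X⟧} (hP : eulerSeries ^ 3 =
    expand 3 (by norm_num) P - 3 * (X * expand 9 (by norm_num) eulerSeries ^ 3)) :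
    (expand 3 (by norm_num) P ^ 3 - 27 * (X * expand 9 (by norm_num) eulerSeries ^ 3) ^ 3) *
      expand 9 (by norm_num) eulerSeries ^ 3 = expand 3 (by norm_num) eulerSeries ^ 12 := by
  obtain ⟨ω, hω⟩ : ∃ ω : ℂ, 1 + ω + ω ^ 2 = 0 := by
    obtain ⟨s, hs⟩ := IsAlgClosed.exists_pow_nat_eq (-3 : ℂ) two_pos
    exact ⟨(-1 + s) / 2, by linear_combination hs / 4⟩
  have h3 : ω ^ 3 = 1 := by linear_combination (ω - 1) * hω
  have h3' : (ω ^ 2) ^ 3 = 1 := by rw [← pow_mul, mul_comm, pow_mul, h3, one_pow]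
  have h9 : expand 9 (by norm_num) eulerSeries =
      expand 3 (by norm_num) (expand 3 (by norm_num) eulerSeries) := by
    rw [← expand_mul]
  apply PowerSeries.map_injective (Int.castRingHom ℂ) Int.cast_injective
  have h0 := congrArg (PowerSeries.map (Int.castRingHom ℂ)) hP
  have hr {a : ℂ} (ha : a ^ 3 = 1) : rescale a (PowerSeries.map (Int.castRingHom ℂ) eulerSeries) ^ 3
      = PowerSeries.map (Int.castRingHom ℂ) (expand 3 (by norm_num) P) - 3 * (C a * X *
        PowerSeries.map (Int.castRingHom ℂ) (expand 9 (by norm_num) eulerSeries) ^ 3) := by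
    rw [← map_pow, ← map_pow, h0, h9]
    simp only [map_mul, map_sub, map_pow, map_ofNat, map_X, rescale_X]
    simp only [map_expand, rescale_expand_three ha]
  have hn := congrArg (· ^ 3) (norm_eulerSeries hω)
  simp only [mul_pow _ _ 3, hr h3, hr h3'] at hn
  simp only [map_mul, map_sub, map_pow, map_ofNat, map_X] at h0 hn ⊢
  rw [h0] at hn
  have hC : 1 + C ω + C ω ^ 2 = (0 : ℂ⟦X⟧) := by
    rw [← map_pow, ← map_one C, ← map_add, ← map_add, hω, map_zero]
  generalize PowerSeries.map (Int.castRingHom ℂ) (expand 3 (by norm_num) P) = p at hn ⊢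
  generalize PowerSeries.map (Int.castRingHom ℂ) (expand 9 (by norm_num) eulerSeries) = b at hn ⊢
  generalize PowerSeries.map (Int.castRingHom ℂ) (expand 3 (by norm_num) eulerSeries) = c at hn ⊢
  generalize (C ω : ℂ⟦X⟧) = w at hn hC
  have hw : w ^ 3 = 1 := by linear_combination (w - 1) * hC
  have key : (p - 3 * (X * b ^ 3)) * (p - 3 * (w * X * b ^ 3)) * (p - 3 * (w ^ 2 * X * b ^ 3)) =
      p ^ 3 - 27 * (X * b ^ 3) ^ 3 := by
    linear_combination (-3 * p ^ 2 * (X * b ^ 3) + 9 * p * (X * b ^ 3) ^ 2 * w) * hC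
      - 27 * (X * b ^ 3) ^ 3 * hw
  rw [← key, hn]
  ring

/-! ### The trisection operator -/

/-- Substitution of `X ^ 3` for `X`. -/
noncomputable abbrev expandThree := expand (R := ℤ) 3 (by norm_num)

/-- The operator `∑ a n X ^ n ↦ ∑ a (3 n) X ^ n`. -/
noncomputable def trisect : ℤ⟦X⟧ →+ ℤ⟦X⟧ where
  toFun f := PowerSeries.mk fun n ↦ coeff (3 * n) f
  map_add' f g := by ext n; simp
  map_zero' := by ext n; simp

@[simp] lemma coeff_trisect (n : ℕ) (f : ℤ⟦X⟧) : coeff n (trisect f) = coeff (3 * n) f := by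
  simp [trisect]

lemma coeff_succ_trisect_X_mul (n : ℕ) (f : ℤ⟦X⟧) :
    coeff (n + 1) (trisect (X * f)) = coeff (3 * n + 2) f := by
  rw [coeff_trisect, show 3 * (n + 1) = 3 * n + 2 + 1 by ring, coeff_succ_X_mul]

lemma trisect_expandThree_mul (g f : ℤ⟦X⟧) : trisect (expandThree g * f) = g * trisect f := by
  ext n
  rw [coeff_trisect, coeff_mul, coeff_mul]
  symm
  refine Finset.sum_of_injOn (fun p ↦ (3 * p.1, 3 * p.2)) ?_ ?_ ?_ ?_
  · rintro ⟨a, b⟩ _ ⟨c, d⟩ _ h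
    simp only [Prod.mk.injEq] at h ⊢
    omega
  · rintro ⟨a, b⟩ h
    simp only [Finset.mem_coe, Finset.HasAntidiagonal.mem_antidiagonal] at h ⊢
    omega
  · rintro ⟨a, b⟩ h h'
    rw [Finset.HasAntidiagonal.mem_antidiagonal] at h
    rw [coeff_expand_of_not_dvd, zero_mul]
    rintro ⟨k, hk⟩
    refine h' ⟨(k, n - k), ?_, ?_⟩
    · simp only [Finset.mem_coe, Finset.HasAntidiagonal.mem_antidiagonal]
      simp only at h hk; omega
    · simp only [Prod.mk.injEq]
      simp only at h hk; omega
  · rintro ⟨a, b⟩ _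
    simp

@[simp] lemma trisect_expandThree (g : ℤ⟦X⟧) : trisect (expandThree g) = g := by
  ext n; simp

@[simp] lemma trisect_X_mul_expandThree (g : ℤ⟦X⟧) : trisect (X * expandThree g) = 0 := by
  ext n
  rw [coeff_trisect]
  rcases n with _ | n
  · simp
  · rw [show 3 * (n + 1) = 3 * n + 2 + 1 by ring, coeff_succ_X_mul,
      coeff_expand_of_not_dvd _ _ _ (by omega), map_zero]

@[simp] lemma trisect_X_sq_mul_expandThree (g : ℤ⟦X⟧) :
    trisect (X ^ 2 * expandThree g) = 0 := by
  ext n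
  rw [coeff_trisect, pow_two, mul_assoc]
  rcases n with _ | n
  · simp
  · rw [show 3 * (n + 1) = 3 * n + 1 + 1 + 1 by ring, coeff_succ_X_mul, coeff_succ_X_mul,
      coeff_expand_of_not_dvd _ _ _ (by omega), map_zero]

lemma trisect_ofNat_mul (a : ℕ) [a.AtLeastTwo] (f : ℤ⟦X⟧) :
    trisect (OfNat.ofNat a * f) = OfNat.ofNat a * trisect f := by
  have := trisect_expandThree_mul (OfNat.ofNat a) f
  rwa [map_ofNat] at this

lemma trisect_pow_mul (N : ℕ) (f : ℤ⟦X⟧) : trisect (3 ^ N * f) = 3 ^ N * trisect f := by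
  have := trisect_expandThree_mul (3 ^ N) f
  rwa [map_pow, map_ofNat] at this

/-! ### Modular functions of level 9 and 3 and their trisections -/

/-- The part of the cube of Euler's product supported on the multiples of 3. -/
noncomputable def cubePart : ℤ⟦X⟧ := Classical.choose exists_eulerSeries_pow_three_eq

lemma expand_nine_eq (f : ℤ⟦X⟧) :
    expand 9 (by norm_num) f = expandThree (expandThree f) := by
  rw [← expand_mul]

lemma cubePart_spec : eulerSeries ^ 3 =
    expand 3 (by norm_num) cubePart - 3 * (X * expand 9 (by norm_num) eulerSeries ^ 3) :=
  Classical.choose_spec exists_eulerSeries_pow_three_eq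

lemma eulerSeries_pow_three : eulerSeries ^ 3 =
    expandThree cubePart - 3 * (X * expandThree (expandThree eulerSeries) ^ 3) := by
  linear_combination cubePart_spec - 3 * X * congrArg (· ^ 3) (expand_nine_eq eulerSeries)

lemma cubePart_norm : (expandThree cubePart ^ 3 -
      27 * (X * expandThree (expandThree eulerSeries) ^ 3) ^ 3) *
    expandThree (expandThree eulerSeries) ^ 3 = expandThree eulerSeries ^ 12 := by
  have h := dissection_norm cubePart_spec
  have e := expand_nine_eq eulerSeries
  linear_combination h - expandThree cubePart ^ 3 * congrArg (· ^ 3) e +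
    27 * X ^ 3 * congrArg (· ^ 12) e

lemma expandThree_mul_inv : expandThree eulerSeries * expandThree eulerInv = 1 := by
  rw [← map_mul, eulerSeries_mul_eulerInv, map_one]

lemma expandThree_expandThree_mul_inv :
    expandThree (expandThree eulerSeries) * expandThree (expandThree eulerInv) = 1 := by
  rw [← map_mul, expandThree_mul_inv, map_one]

/-- The 3-dissection of the inverse cube of Euler's product. -/
lemma eulerInv_pow_three : eulerInv ^ 3 =
    expandThree (expandThree eulerSeries ^ 3 * eulerInv ^ 12) *
      (expandThree cubePart ^ 2 +
        3 * expandThree cubePart * (X * expandThree (expandThree eulerSeries) ^ 3) +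
        9 * (X * expandThree (expandThree eulerSeries) ^ 3) ^ 2) := by
  have h1 : eulerSeries ^ 3 * eulerInv ^ 3 = 1 := by
    rw [← mul_pow, eulerSeries_mul_eulerInv, one_pow]
  have h12 : expandThree eulerSeries ^ 12 * expandThree eulerInv ^ 12 = 1 := by
    rw [← mul_pow, expandThree_mul_inv, one_pow]
  have hn := cubePart_norm
  rw [map_mul, map_pow, map_pow]
  rw [eulerSeries_pow_three] at h1
  generalize expandThree (expandThree eulerSeries) = b at *
  generalize expandThree cubePart = p at *
  -- With `x = X b^3`, this is `(p - 3x)(p^2 + 3px + 9x^2) = p^3 - 27x^3`, the last being known from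
  -- the norm.
  linear_combination (b ^ 3 * expandThree eulerInv ^ 12 * (p ^ 2 + 3 * p * (X * b ^ 3)
    + 9 * (X * b ^ 3) ^ 2)) * h1 - expandThree eulerInv ^ 12 * eulerInv ^ 3 * hn - eulerInv ^ 3 * h12

/-- `q E(q ^ 9) ^ 3 / E(q) ^ 3`. -/
noncomputable def cubeQuot : ℤ⟦X⟧ := X * expandThree (expandThree eulerSeries) ^ 3 * eulerInv ^ 3

/-- `q E(q ^ 3) ^ 12 / E(q) ^ 12`. -/
noncomputable def hauptmodul : ℤ⟦X⟧ := X * expandThree eulerSeries ^ 12 * eulerInv ^ 12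

lemma expandThree_hauptmodul : expandThree hauptmodul =
    (X * expandThree (expandThree eulerSeries) ^ 3) ^ 3 *
      expandThree (expandThree eulerSeries ^ 3 * eulerInv ^ 12) := by
  simp only [hauptmodul, map_mul, map_pow, expand_X]
  ring

lemma cubeQuot_eq : cubeQuot =
    X * expandThree (expandThree eulerSeries ^ 6 * eulerInv ^ 12 * cubePart ^ 2) +
    (X ^ 2 * expandThree (3 * expandThree eulerSeries ^ 9 * eulerInv ^ 12 * cubePart) +
    9 * expandThree hauptmodul) := by
  rw [cubeQuot, eulerInv_pow_three, expandThree_hauptmodul]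
  simp only [map_mul, map_pow, map_ofNat]
  ring

lemma trisect_cubeQuot : trisect cubeQuot = 9 * hauptmodul := by
  rw [cubeQuot_eq, map_add, map_add, trisect_X_mul_expandThree, trisect_X_sq_mul_expandThree,
    trisect_ofNat_mul, trisect_expandThree, zero_add, zero_add]

lemma expandThree_mul_cubePart_pow_three :
    expandThree (expandThree eulerSeries ^ 3 * eulerInv ^ 12) * expandThree cubePart ^ 3 =
      1 + 27 * expandThree hauptmodul := by
  have h12 : expandThree eulerSeries ^ 12 * expandThree eulerInv ^ 12 = 1 := by
    rw [← mul_pow, expandThree_mul_inv, one_pow]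
  have hn := cubePart_norm
  rw [expandThree_hauptmodul, map_mul, map_pow, map_pow]
  linear_combination expandThree eulerInv ^ 12 * hn + h12

lemma trisect_cubeQuot_sq : trisect (cubeQuot ^ 2) = 6 * hauptmodul + 243 * hauptmodul ^ 2 := by
  have h : cubeQuot ^ 2 =
      X ^ 2 * expandThree ((expandThree eulerSeries ^ 3 * eulerInv ^ 12) ^ 2 *
          (expandThree eulerSeries ^ 6 * cubePart ^ 4 +
            54 * X * expandThree eulerSeries ^ 15 * cubePart)) +
      (X * expandThree (27 * X * (expandThree eulerSeries ^ 3 * eulerInv ^ 12) ^ 2 *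
          expandThree eulerSeries ^ 12 * cubePart ^ 2) +
      expandThree (6 * hauptmodul + 243 * hauptmodul ^ 2)) := by
    have hB := expandThree_hauptmodul
    have hp := expandThree_mul_cubePart_pow_three
    rw [cubeQuot, eulerInv_pow_three]
    simp only [map_add, map_mul, map_pow, map_ofNat, expand_X] at hB hp ⊢
    rw [hB] at hp ⊢
    linear_combination (6 * X ^ 3 * expandThree (expandThree eulerSeries) ^ 12 *
      expandThree eulerInv ^ 12) * hp
  rw [h, map_add, map_add, trisect_X_mul_expandThree, trisect_X_sq_mul_expandThree,
    trisect_expandThree, zero_add, zero_add]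

/-- With `x = q E(q^9)^3` and `p = P(q^3)`, the dissection of `E^3` gives `p / E^3 = 1 + 3ζ`.
Multiplying the dissection of `E^(-3)` by `x^3 E^(-6)` then turns `p^2 + 3px + 9x^2` into `(1 +
3ζ)^2 + 3ζ(1 + 3ζ) + 9ζ^2`. -/
lemma cubeQuot_pow_three : cubeQuot ^ 3 =
    expandThree hauptmodul * (27 * cubeQuot ^ 2 + 9 * cubeQuot + 1) := by
  have h1 : eulerSeries ^ 3 * eulerInv ^ 3 = 1 := by
    rw [← mul_pow, eulerSeries_mul_eulerInv, one_pow]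
  have hA := eulerSeries_pow_three
  have hF := eulerInv_pow_three
  rw [expandThree_hauptmodul, cubeQuot]
  generalize expandThree (expandThree eulerSeries ^ 3 * eulerInv ^ 12) = D at *
  generalize expandThree (expandThree eulerSeries) = b at *
  generalize expandThree cubePart = p at *
  rw [hA] at h1
  generalize eulerInv ^ 3 = f at *
  linear_combination (X * b ^ 3) ^ 3 * f ^ 2 * hF +
    (X * b ^ 3) ^ 3 * D * (p * f + 6 * (X * b ^ 3) * f + 1) * h1

lemma cubeQuot_pow_four : cubeQuot ^ 4 = hauptmodul * expandThree hauptmodul := by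
  have h12 : expandThree eulerSeries ^ 12 * expandThree eulerInv ^ 12 = 1 := by
    rw [← mul_pow, expandThree_mul_inv, one_pow]
  rw [cubeQuot]
  simp only [hauptmodul, map_mul, map_pow, expand_X]
  linear_combination -X ^ 4 * expandThree (expandThree eulerSeries) ^ 12 * eulerInv ^ 12 * h12

lemma hauptmodul_ne_zero : hauptmodul ≠ 0 := by
  have hE : eulerSeries ≠ 0 := left_ne_zero_of_mul_eq_one eulerSeries_mul_eulerInv
  have hF : eulerInv ≠ 0 := right_ne_zero_of_mul_eq_one eulerSeries_mul_eulerInv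
  have hE3 : expandThree eulerSeries ≠ 0 := left_ne_zero_of_mul_eq_one expandThree_mul_inv
  exact mul_ne_zero (mul_ne_zero X_ne_zero (pow_ne_zero _ hE3)) (pow_ne_zero _ hF)

lemma three_pow_ne_zero (n : ℕ) : (3 : ℤ⟦X⟧) ^ n ≠ 0 := by
  have : (3 : ℤ⟦X⟧) ≠ 0 := by
    intro h
    have := congrArg (constantCoeff (R := ℤ)) h
    rw [map_ofNat, map_zero] at this
    norm_num at this
  exact pow_ne_zero _ this

/-- The trisections of the powers of `3 * cubeQuot` are polynomials in `27 * hauptmodul`, with a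
zero of the expected order. -/
lemma exists_trisect_pow (n : ℕ) : ∃ k : Polynomial ℤ, trisect ((3 * cubeQuot) ^ n) =
    (27 * hauptmodul) ^ ((n + 2) / 3) * Polynomial.aeval (27 * hauptmodul) k := by
  induction n using Nat.strong_induction_on with
  | _ n ih =>
    match n with
    | 0 =>
      refine ⟨1, ?_⟩
      have := trisect_expandThree 1
      rw [map_one] at this
      simp [this]
    | 1 =>
      refine ⟨1, ?_⟩
      rw [pow_one, trisect_ofNat_mul, trisect_cubeQuot]
      simp
      ring
    | 2 =>
      refine ⟨2 + 3 * Polynomial.X, ?_⟩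
      have h : (3 * cubeQuot) ^ 2 = 3 ^ 2 * cubeQuot ^ 2 := by ring
      rw [h, trisect_pow_mul, trisect_cubeQuot_sq]
      simp only [map_add, map_mul, Polynomial.aeval_X, map_ofNat]
      norm_num
      ring
    | n + 3 =>
      obtain ⟨k0, h0⟩ := ih n (by omega)
      obtain ⟨k1, h1⟩ := ih (n + 1) (by omega)
      obtain ⟨k2, h2⟩ := ih (n + 2) (by omega)
      obtain ⟨d1, e1⟩ : ∃ d, (n + 1 + 2) / 3 = (n + 2) / 3 + d :=
        ⟨(n + 1 + 2) / 3 - (n + 2) / 3, by omega⟩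
      obtain ⟨d2, e2⟩ : ∃ d, (n + 2 + 2) / 3 = (n + 2) / 3 + d :=
        ⟨(n + 2 + 2) / 3 - (n + 2) / 3, by omega⟩
      have e3 : (n + 3 + 2) / 3 = (n + 2) / 3 + 1 := by omega
      refine ⟨3 * Polynomial.X ^ d2 * k2 + 3 * Polynomial.X ^ d1 * k1 + k0, ?_⟩
      -- The modular equation scaled by 27: a recursion with integer coefficients in `3ζ` and one
      -- factor `27 Y(q^3)`, which leaves `U` as `27Y`.
      have h : (3 * cubeQuot) ^ (n + 3) = expandThree (27 * hauptmodul) *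
          (3 * (3 * cubeQuot) ^ (n + 2) + (3 * (3 * cubeQuot) ^ (n + 1) + (3 * cubeQuot) ^ n)) := by
        rw [map_mul, map_ofNat]
        linear_combination 27 * (3 * cubeQuot) ^ n * cubeQuot_pow_three
      rw [h, trisect_expandThree_mul, map_add, map_add, trisect_ofNat_mul, trisect_ofNat_mul,
        h0, h1, h2, e1, e2, e3]
      simp only [map_add, map_mul, map_pow, Polynomial.aeval_X, map_ofNat]
      ring

lemma exists_trisect_pow_of_lt {i m : ℕ} (h : 3 * i < m) : ∃ k : Polynomial ℤ,
    trisect ((3 * cubeQuot) ^ m) =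
      (27 * hauptmodul) ^ (i + 1) * Polynomial.aeval (27 * hauptmodul) k := by
  obtain ⟨k, hk⟩ := exists_trisect_pow m
  obtain ⟨d, hd⟩ : ∃ d, (m + 2) / 3 = i + 1 + d := ⟨(m + 2) / 3 - (i + 1), by omega⟩
  refine ⟨Polynomial.X ^ d * k, ?_⟩
  rw [hk, hd, map_mul, map_pow, Polynomial.aeval_X]
  ring

/-! ### Lattice points and the two maps that preserve them -/

/-- The series `3 ^ N * Y * k (9 * Y)`, where `Y` is `hauptmodul` and `k` is an integer
polynomial. -/
def IsLatticePoint (N : ℕ) (f : ℤ⟦X⟧) : Prop :=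
  ∃ k : Polynomial ℤ, f = 3 ^ N * (hauptmodul * Polynomial.aeval (9 * hauptmodul) k)

lemma IsLatticePoint.add {N : ℕ} {f g : ℤ⟦X⟧} (hf : IsLatticePoint N f) (hg : IsLatticePoint N g) :
    IsLatticePoint N (f + g) := by
  obtain ⟨k, rfl⟩ := hf
  obtain ⟨l, rfl⟩ := hg
  exact ⟨k + l, by rw [map_add]; ring⟩

lemma IsLatticePoint.three_pow_mul {N : ℕ} {f : ℤ⟦X⟧} (hf : IsLatticePoint N f) (M : ℕ) :
    IsLatticePoint (M + N) (3 ^ M * f) := by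
  obtain ⟨k, rfl⟩ := hf
  exact ⟨k, by ring⟩

lemma IsLatticePoint.intCast_mul {N : ℕ} {f : ℤ⟦X⟧} (hf : IsLatticePoint N f) (a : ℤ) :
    IsLatticePoint N (a * f) := by
  obtain ⟨k, rfl⟩ := hf
  exact ⟨a * k, by rw [map_mul, map_intCast]; ring⟩

lemma aeval_twentySeven_eq (k : Polynomial ℤ) (h : ℤ⟦X⟧) :
    Polynomial.aeval (27 * h) k = Polynomial.aeval (9 * h) (k.comp (3 * Polynomial.X)) := by
  rw [Polynomial.aeval_comp, map_mul, Polynomial.aeval_X, map_ofNat]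
  congr 2
  ring

lemma trisect_intCast_mul (a : ℤ) (f : ℤ⟦X⟧) : trisect (a * f) = a * trisect f := by
  have := trisect_expandThree_mul a f
  rwa [map_intCast] at this

/-- A criterion for `f ↦ trisect (f * w)` to map lattice points to lattice points. -/
lemma IsLatticePoint.trisect_mul {w : ℤ⟦X⟧} {M : ℕ}
    (hw : ∀ i, IsLatticePoint M (trisect (3 ^ (2 * i) * (hauptmodul ^ (i + 1) * w))))
    {N : ℕ} {f : ℤ⟦X⟧} (hf : IsLatticePoint N f) : IsLatticePoint (N + M) (trisect (f * w)) := by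
  obtain ⟨k, rfl⟩ := hf
  rw [mul_assoc, trisect_pow_mul]
  refine IsLatticePoint.three_pow_mul ?_ N
  induction k using Polynomial.induction_on' with
  | add p q hp hq =>
    rw [map_add, mul_add, add_mul, map_add]
    exact hp.add hq
  | monomial i a =>
    have e : hauptmodul * Polynomial.aeval (9 * hauptmodul) (Polynomial.monomial i a) * w =
        (a : ℤ⟦X⟧) * (3 ^ (2 * i) * (hauptmodul ^ (i + 1) * w)) := by
      rw [Polynomial.aeval_monomial, mul_pow, pow_mul, eq_intCast]
      ring
    rw [e, trisect_intCast_mul]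
    exact (hw i).intCast_mul a

/-- Trisection may cost a denominator `3 ^ i` at degree `i + 1`; the weight `3 ^ (2 * i)` of that
degree in the lattice pays for it. -/
lemma isLatticePoint_trisect_of_pow {w : ℤ⟦X⟧} {M i : ℕ} {k : Polynomial ℤ}
    (h : 3 ^ i * trisect w = 3 ^ M * (hauptmodul * Polynomial.aeval (27 * hauptmodul) k)) :
    IsLatticePoint M (trisect (3 ^ (2 * i) * w)) := by
  refine ⟨3 ^ i * k.comp (3 * Polynomial.X), ?_⟩
  rw [trisect_pow_mul, map_mul, map_pow, map_ofNat, ← aeval_twentySeven_eq]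
  linear_combination 3 ^ i * h

/-- From `ζ^4 = Y Y(q^3)`, `U(ζ^(4m)) = Y^m U(Y^m)`. For `m = i + 1`, the series `U((3ζ)^(4m))` is
divisible by `(27Y)^(i + 2)`, and `3(i + 2) - 4(i + 1) = 2 - i` gives the gain `3^2` and the loss
`3^i`. With an extra factor `ζ` the difference is `1 - i`, whence the gain of 1 in the next lemma.
-/
lemma IsLatticePoint.trisect {N : ℕ} {f : ℤ⟦X⟧} (hf : IsLatticePoint N f) :
    IsLatticePoint (N + 2) (trisect f) := by
  rw [← mul_one f]
  refine hf.trisect_mul fun i ↦ ?_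
  obtain ⟨k, hk⟩ := exists_trisect_pow_of_lt (i := i + 1) (m := 4 * (i + 1)) (by omega)
  refine isLatticePoint_trisect_of_pow (k := k) ?_
  have e : (3 * cubeQuot) ^ (4 * (i + 1)) = 3 ^ (4 * (i + 1)) *
      (expandThree (hauptmodul ^ (i + 1)) * hauptmodul ^ (i + 1)) := by
    rw [mul_pow, pow_mul cubeQuot, cubeQuot_pow_four, mul_pow, map_pow]
    ring
  rw [e, trisect_pow_mul, trisect_expandThree_mul] at hk
  rw [mul_one]
  refine mul_left_cancel₀ (mul_ne_zero (three_pow_ne_zero (3 * i + 4))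
    (pow_ne_zero (i + 1) hauptmodul_ne_zero)) ?_
  rw [mul_pow, show (27 : ℤ⟦X⟧) = 3 ^ 3 by norm_num, ← pow_mul] at hk
  rw [show (27 : ℤ⟦X⟧) = 3 ^ 3 by norm_num]
  linear_combination hk

lemma IsLatticePoint.trisect_mul_cubeQuot {N : ℕ} {f : ℤ⟦X⟧} (hf : IsLatticePoint N f) :
    IsLatticePoint (N + 1) (_root_.trisect (f * cubeQuot)) := by
  refine hf.trisect_mul fun i ↦ ?_
  obtain ⟨k, hk⟩ := exists_trisect_pow_of_lt (i := i + 1) (m := 4 * (i + 1) + 1) (by omega)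
  refine isLatticePoint_trisect_of_pow (k := k) ?_
  have e : (3 * cubeQuot) ^ (4 * (i + 1) + 1) = 3 ^ (4 * (i + 1) + 1) *
      (expandThree (hauptmodul ^ (i + 1)) * (hauptmodul ^ (i + 1) * cubeQuot)) := by
    rw [mul_pow, pow_succ cubeQuot, pow_mul cubeQuot, cubeQuot_pow_four, mul_pow, map_pow]
    ring
  rw [e, trisect_pow_mul, trisect_expandThree_mul] at hk
  refine mul_left_cancel₀ (mul_ne_zero (three_pow_ne_zero (3 * i + 5))
    (pow_ne_zero (i + 1) hauptmodul_ne_zero)) ?_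
  rw [mul_pow, show (27 : ℤ⟦X⟧) = 3 ^ 3 by norm_num, ← pow_mul] at hk
  rw [show (27 : ℤ⟦X⟧) = 3 ^ 3 by norm_num]
  linear_combination hk

lemma IsLatticePoint.exists_eq {N : ℕ} {f : ℤ⟦X⟧} (hf : IsLatticePoint N f) :
    ∃ (c : ℤ) (g : ℤ⟦X⟧), f = 3 ^ N * (c * hauptmodul + 9 * g) := by
  obtain ⟨k, rfl⟩ := hf
  refine ⟨k.coeff 0, hauptmodul ^ 2 * Polynomial.aeval (9 * hauptmodul) k.divX, ?_⟩
  conv_lhs => rw [← Polynomial.divX_mul_X_add k]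
  rw [map_add, map_mul, Polynomial.aeval_X, Polynomial.aeval_C, eq_intCast]
  ring

/-! ### Extra divisibility of the leading term -/

lemma eulerInv_pow_three_eq_add : ∃ g : ℤ⟦X⟧, eulerInv ^ 3 =
    expandThree (expandThree eulerSeries ^ 3 * eulerInv ^ 12 * cubePart ^ 2) + 3 * g := by
  refine ⟨expandThree (expandThree eulerSeries ^ 3 * eulerInv ^ 12) *
    (expandThree cubePart * (X * expandThree (expandThree eulerSeries) ^ 3) +
        3 * (X * expandThree (expandThree eulerSeries) ^ 3) ^ 2), ?_⟩
  rw [eulerInv_pow_three, map_mul _ _ (cubePart ^ 2), map_pow]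
  ring

/-- Modulo 3, `E^(-3)` is a series in `q^3`, so its cube, and hence its sixth power, is one modulo
9. Writing `E^(-15) = E^3 (E^(-3))^6` and dissecting `E^3` leaves, modulo 9, only exponents
congruent to 1 and 2 modulo 3. -/
lemma nine_dvd_trisect_hauptmodul_mul :
    (9 : ℤ⟦X⟧) ∣ trisect (hauptmodul * eulerInv ^ 3) := by
  obtain ⟨g, hg⟩ := eulerInv_pow_three_eq_add
  set a := expandThree eulerSeries ^ 3 * eulerInv ^ 12 * cubePart ^ 2
  have h1 : eulerSeries ^ 3 * eulerInv ^ 3 = 1 := by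
    rw [← mul_pow, eulerSeries_mul_eulerInv, one_pow]
  have e : hauptmodul * eulerInv ^ 3 = X * expandThree (eulerSeries ^ 12 * a ^ 6 * cubePart) +
      (X ^ 2 * expandThree (-3 * eulerSeries ^ 12 * a ^ 6 * expandThree eulerSeries ^ 3) +
      9 * (X * expandThree eulerSeries ^ 12 * eulerSeries ^ 3 *
        ((expandThree a ^ 2 * g + 3 * expandThree a * g ^ 2 + 3 * g ^ 3) *
          (2 * expandThree a ^ 3 + 9 * (expandThree a ^ 2 * g + 3 * expandThree a * g ^ 2 + 3 * g ^ 3))))) := by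
    have e1 : hauptmodul * eulerInv ^ 3 =
        X * expandThree eulerSeries ^ 12 * eulerSeries ^ 3 * (eulerInv ^ 3) ^ 6 := by
      rw [hauptmodul]
      linear_combination -X * expandThree eulerSeries ^ 12 * eulerInv ^ 15 * h1
    rw [e1, hg]
    simp only [map_mul, map_pow, map_neg, map_ofNat]
    linear_combination X * expandThree eulerSeries ^ 12 * expandThree a ^ 6 * eulerSeries_pow_three
  rw [e, map_add, map_add, trisect_X_mul_expandThree, trisect_X_sq_mul_expandThree,
    trisect_ofNat_mul, zero_add, zero_add]
  exact dvd_mul_right _ _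

/-- Modulo 3, `E^(-12)` is a series in `q^3`, so after multiplication by `X` only exponents
congruent to 2 modulo 3 survive. -/
lemma three_dvd_trisect_X_mul_hauptmodul_mul :
    (3 : ℤ⟦X⟧) ∣ trisect (X * (hauptmodul * expandThree (eulerInv ^ 3))) := by
  obtain ⟨g, hg⟩ := eulerInv_pow_three_eq_add
  set a := expandThree eulerSeries ^ 3 * eulerInv ^ 12 * cubePart ^ 2
  have e : X * (hauptmodul * expandThree (eulerInv ^ 3)) =
      X ^ 2 * expandThree (eulerSeries ^ 12 * a ^ 4 * eulerInv ^ 3) +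
      3 * (X ^ 2 * expandThree eulerSeries ^ 12 * expandThree eulerInv ^ 3 *
        (4 * expandThree a ^ 3 * g + 18 * expandThree a ^ 2 * g ^ 2 + 36 * expandThree a * g ^ 3 +
          27 * g ^ 4)) := by
    have e1 : hauptmodul = X * expandThree eulerSeries ^ 12 * (expandThree a + 3 * g) ^ 4 := by
      rw [hauptmodul, ← hg]
      ring
    rw [e1]
    simp only [map_mul, map_pow]
    ring
  rw [e, map_add, trisect_X_sq_mul_expandThree, trisect_ofNat_mul, zero_add]
  exact dvd_mul_right _ _

/-! ### Iterated trisection of the generating function -/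

/-- `E(q ^ 3) ^ 3 / E(q) ^ 3`. -/
noncomputable def cubeRatio : ℤ⟦X⟧ := (expandThree eulerSeries * eulerInv) ^ 3

lemma expandThree_expand (m : ℕ) (hm : m ≠ 0) (f : ℤ⟦X⟧) :
    expand (3 * m) (by positivity) f = expandThree (expand m hm f) := expand_mul 3 _ m hm f

lemma expand_congr {a b : ℕ} (h : a = b) (ha : a ≠ 0) (hb : b ≠ 0) (f : ℤ⟦X⟧) :
    expand a ha f = expand b hb f := by
  subst h; rfl

/-- `q E^(-3) = ζ E(q^9)^(-3)`, and the last factor passes through the trisection. Together with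
`trisect_mul_mul` this makes the weights `E(q)^(-3)` and `E(q^3)^(-3)` alternate. -/
lemma trisect_X_mul_mul (f g : ℤ⟦X⟧) :
    trisect (X * (f * eulerInv ^ 3 * expandThree g)) =
      trisect (f * cubeQuot) * expandThree (eulerInv ^ 3) * g := by
  have h : expandThree (expandThree eulerSeries) ^ 3 * expandThree (expandThree eulerInv) ^ 3 = 1 := by
    rw [← mul_pow, expandThree_expandThree_mul_inv, one_pow]
  have e : X * (f * eulerInv ^ 3 * expandThree g) =
      expandThree (expandThree (eulerInv ^ 3) * g) * (f * cubeQuot) := by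
    rw [cubeQuot]
    simp only [map_mul, map_pow]
    linear_combination -f * X * eulerInv ^ 3 * expandThree g * h
  rw [e, trisect_expandThree_mul]
  ring

lemma trisect_mul_mul (f g : ℤ⟦X⟧) :
    trisect (f * expandThree (eulerInv ^ 3) * expandThree g) = trisect f * eulerInv ^ 3 * g := by
  rw [mul_assoc, ← map_mul, mul_comm, trisect_expandThree_mul]
  ring

/-- The free factor `M` serves the induction: two further trisections replace `9 * M` by `M`. At `M
= 1` the factor `cubeRatio` turns `E(q^3)^(-3)` back into `E(q)^(-3)`. -/
lemma exists_coeff_eq (α M : ℕ) (hM : M ≠ 0) : ∃ (l : ℤ⟦X⟧) (c : ℕ),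
    IsLatticePoint (3 * α + 2) l ∧ 8 * c = 5 * 3 ^ (2 * α + 1) + 1 ∧
    ∀ n, coeff (3 ^ (2 * α + 1) * n + c)
        (eulerInv ^ 3 * expand (3 ^ (2 * α + 1) * M) (by positivity) cubeRatio) =
      coeff (n + 1) (l * expandThree (eulerInv ^ 3) * expand M hM cubeRatio) := by
  induction α generalizing M with
  | zero =>
    refine ⟨trisect (1 * cubeQuot), 2, ?_, by norm_num, fun n ↦ ?_⟩
    · refine ⟨1, ?_⟩
      rw [one_mul, trisect_cubeQuot, map_one]
      ring
    · rw [← trisect_X_mul_mul, coeff_succ_trisect_X_mul, ← expandThree_expand, one_mul]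
      simp
  | succ α ih =>
    obtain ⟨l, c, hl, hc, h⟩ := ih (9 * M) (by positivity)
    refine ⟨trisect (trisect l * cubeQuot), 3 ^ (2 * α + 1) * 5 + c, ?_, ?_, fun n ↦ ?_⟩
    · have := hl.trisect.trisect_mul_cubeQuot
      rwa [show 3 * α + 2 + 2 + 1 = 3 * (α + 1) + 2 by ring] at this
    · rw [show 3 ^ (2 * (α + 1) + 1) = 9 * 3 ^ (2 * α + 1) by ring]
      omega
    -- Position `9n + 5` has shifted index `9n + 6 = 3(3n + 2)`: `U` sends it to `3n + 2`, and `U(X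
    -- ·)` sends that to `n + 1`.
    · rw [expand_congr (b := 3 ^ (2 * α + 1) * (9 * M)) (by ring) _ (by positivity),
        show 3 ^ (2 * (α + 1) + 1) * n + (3 ^ (2 * α + 1) * 5 + c) =
          3 ^ (2 * α + 1) * (9 * n + 5) + c by ring, h,
        ← trisect_X_mul_mul, coeff_succ_trisect_X_mul, ← trisect_mul_mul, coeff_trisect,
        ← expandThree_expand M hM, ← expandThree_expand (3 * M) (by positivity),
        expand_congr (a := 9 * M) (b := 3 * (3 * M)) (by ring) _ (by positivity)]
      congr 1
      ring_nf

lemma coeff_pPM (k n : ℕ) : (pPM k n : ℤ) =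
    coeff n (eulerInv ^ 3 * expand (3 ^ k) (by positivity) cubeRatio) := by
  rw [cubeRatio, ← mk_pPM, coeff_mk]

lemma exists_pPM_eq (α β : ℕ) : ∃ (l : ℤ⟦X⟧) (d : ℕ),
    IsLatticePoint (3 * α + 3 * β + 2) l ∧
    8 * d + 2 * 3 ^ (2 * α + 1) = 7 * 3 ^ (2 * α + 2 * β + 1) + 1 ∧
    ∀ n, (pPM (2 * α + 1) (3 ^ (2 * α + 2 * β + 1) * n + d) : ℤ) =
      coeff (n + 1) (l * eulerInv ^ 3) := by
  induction β with
  | zero =>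
    obtain ⟨l, c, hl, hc, h⟩ := exists_coeff_eq α 1 one_ne_zero
    refine ⟨l, c, hl, ?_, fun n ↦ ?_⟩
    · simp only [mul_zero, add_zero]
      omega
    · have e : l * expandThree (eulerInv ^ 3) * expand 1 one_ne_zero cubeRatio =
          l * eulerInv ^ 3 := by
        have h3 : expandThree eulerSeries ^ 3 * expandThree eulerInv ^ 3 = 1 := by
          rw [← mul_pow, expandThree_mul_inv, one_pow]
        rw [expand_one_apply, cubeRatio, map_pow]
        linear_combination l * eulerInv ^ 3 * h3
      rw [coeff_pPM, ← e, ← h]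
      rw [expand_congr (b := 3 ^ (2 * α + 1) * 1) (mul_one _).symm _ (by positivity)]
  | succ β ih =>
    obtain ⟨l, d, hl, hd, h⟩ := ih
    refine ⟨trisect (trisect (l * cubeQuot)), 3 ^ (2 * α + 2 * β + 1) * 7 + d, ?_, ?_, fun n ↦ ?_⟩
    · exact hl.trisect_mul_cubeQuot.trisect
    · rw [show 2 * α + 2 * (β + 1) + 1 = 2 * α + 2 * β + 1 + 2 by ring, pow_add _ _ 2]
      omega
    · have h1 := trisect_mul_mul (trisect (l * cubeQuot)) 1
      have h2 := trisect_X_mul_mul l 1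
      rw [map_one, mul_one, mul_one] at h1 h2
      -- Position `9n + 7` has shifted index `3(3n + 2) + 2`: `U(X ·)` sends it to `3(n + 1)`, and
      -- `U` sends that to `n + 1`.
      rw [show 3 ^ (2 * α + 2 * (β + 1) + 1) * n + (3 ^ (2 * α + 2 * β + 1) * 7 + d) =
          3 ^ (2 * α + 2 * β + 1) * (9 * n + 7) + d by ring, h, ← h1, ← h2, coeff_trisect,
        show 3 * (n + 1) = 3 * n + 2 + 1 by ring, coeff_succ_trisect_X_mul]
      congr 1
      ring_nf

/-! ### Reading off the congruences -/

lemma dvd_coeff_three_pow_mul (N n : ℕ) (f : ℤ⟦X⟧) : (3 : ℤ) ^ N ∣ coeff n (3 ^ N * f) := by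
  have : (3 : ℤ⟦X⟧) ^ N = C (3 ^ N) := by simp
  rw [this, coeff_C_mul]
  exact dvd_mul_right _ _

lemma IsLatticePoint.dvd_coeff_mul {N : ℕ} {l : ℤ⟦X⟧} (hl : IsLatticePoint N l) (g : ℤ⟦X⟧)
    (n : ℕ) : (3 : ℤ) ^ N ∣ coeff n (l * g) := by
  obtain ⟨k, rfl⟩ := hl
  rw [mul_assoc]
  exact dvd_coeff_three_pow_mul _ _ _

lemma IsLatticePoint.dvd_coeff_three_mul {N : ℕ} {l : ℤ⟦X⟧} (hl : IsLatticePoint N l) (n : ℕ) :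
    (3 : ℤ) ^ (N + 2) ∣ coeff (3 * n) (l * eulerInv ^ 3) := by
  obtain ⟨c, g, rfl⟩ := hl.exists_eq
  obtain ⟨s, hs⟩ := nine_dvd_trisect_hauptmodul_mul
  have e : _root_.trisect (3 ^ N * ((c : ℤ⟦X⟧) * hauptmodul + 9 * g) * eulerInv ^ 3) =
      3 ^ (N + 2) * ((c : ℤ⟦X⟧) * s + _root_.trisect (g * eulerInv ^ 3)) := by
    rw [show 3 ^ N * (c * hauptmodul + 9 * g) * eulerInv ^ 3 =
      3 ^ N * (c * (hauptmodul * eulerInv ^ 3) + 9 * (g * eulerInv ^ 3)) by ring,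
      trisect_pow_mul, map_add, trisect_intCast_mul, hs, trisect_ofNat_mul]
    ring
  rw [← coeff_trisect, e]
  exact dvd_coeff_three_pow_mul _ _ _

lemma IsLatticePoint.dvd_coeff_three_mul_add_two {N : ℕ} {l : ℤ⟦X⟧} (hl : IsLatticePoint N l)
    (n : ℕ) : (3 : ℤ) ^ (N + 1) ∣ coeff (3 * n + 2) (l * expandThree (eulerInv ^ 3)) := by
  obtain ⟨c, g, rfl⟩ := hl.exists_eq
  obtain ⟨s, hs⟩ := three_dvd_trisect_X_mul_hauptmodul_mul
  have e : _root_.trisect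
      (X * (3 ^ N * ((c : ℤ⟦X⟧) * hauptmodul + 9 * g) * expandThree (eulerInv ^ 3))) =
      3 ^ (N + 1) * ((c : ℤ⟦X⟧) * s + 3 * _root_.trisect (X * (g * expandThree (eulerInv ^ 3)))) := by
    rw [show X * (3 ^ N * ((c : ℤ⟦X⟧) * hauptmodul + 9 * g) * expandThree (eulerInv ^ 3)) =
      3 ^ N * ((c : ℤ⟦X⟧) * (X * (hauptmodul * expandThree (eulerInv ^ 3))) +
        9 * (X * (g * expandThree (eulerInv ^ 3)))) by ring,
      trisect_pow_mul, map_add, trisect_intCast_mul, hs, trisect_ofNat_mul]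
    ring
  rw [← coeff_succ_trisect_X_mul, e]
  exact dvd_coeff_three_pow_mul _ _ _

lemma modEq_zero_three_pow_iff (a N : ℕ) : a ≡ 0 [MOD 3 ^ N] ↔ (3 : ℤ) ^ N ∣ (a : ℤ) := by
  rw [Nat.modEq_zero_iff_dvd, ← Int.natCast_dvd_natCast]
  push_cast
  rfl

theorem theorem1p7 (α β n : ℕ) :
    pPM (2 * α + 1)
        (3 ^ (2 * α + 2 * β + 1) * n
          + (7 * 3 ^ (2 * α + 2 * β + 1) - 2 * 3 ^ (2 * α + 1) + 1) / 8)
      ≡ 0 [MOD 3 ^ (3 * α + 3 * β + 2)] ∧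
    pPM (2 * α + 1)
        (3 ^ (2 * α + 2 * β + 2) * n
          + (23 * 3 ^ (2 * α + 2 * β + 1) - 2 * 3 ^ (2 * α + 1) + 1) / 8)
      ≡ 0 [MOD 3 ^ (3 * α + 3 * β + 4)] ∧
    pPM (2 * α + 1)
        (3 ^ (2 * α + 2 * β + 2) * n
          + (5 * 3 ^ (2 * α + 2 * β + 2) - 2 * 3 ^ (2 * α + 1) + 1) / 8)
      ≡ 0 [MOD 3 ^ (3 * α + 3 * β + 3)] ∧
    pPM (2 * α + 1)
        (3 ^ (2 * α + 2 * β + 3) * n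
          + (13 * 3 ^ (2 * α + 2 * β + 2) - 2 * 3 ^ (2 * α + 1) + 1) / 8)
      ≡ 0 [MOD 3 ^ (3 * α + 3 * β + 4)] := by
  obtain ⟨l, d, hl, hd, h⟩ := exists_pPM_eq α β
  have h2 := trisect_X_mul_mul l 1
  rw [map_one, mul_one, mul_one] at h2
  have hle : 3 ^ (2 * α + 1) ≤ 3 ^ (2 * α + 2 * β + 1) :=
    Nat.pow_le_pow_right (by norm_num) (by omega)
  rw [show 3 ^ (2 * α + 2 * β + 3) = 9 * 3 ^ (2 * α + 2 * β + 1) by ring,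
    show 3 ^ (2 * α + 2 * β + 2) = 3 * 3 ^ (2 * α + 2 * β + 1) by ring]
  generalize 3 ^ (2 * α + 2 * β + 1) = x at hd h hle ⊢
  generalize 3 ^ (2 * α + 1) = y at hd hle ⊢
  -- Since `y ≤ x`, the subtractions do not truncate, and the relation for `d` makes the divisions
  -- exact. The other numerators exceed the first by `16x`, `8x` and `32x`.
  have e1 : (7 * x - 2 * y + 1) / 8 = d := by omega
  have e2 : (23 * x - 2 * y + 1) / 8 = x * 2 + d := by omega
  have e3 : (5 * (3 * x) - 2 * y + 1) / 8 = x * 1 + d := by omega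
  have e4 : (13 * (3 * x) - 2 * y + 1) / 8 = x * 4 + d := by omega
  simp only [modEq_zero_three_pow_iff]
  refine ⟨?_, ?_, ?_, ?_⟩
  · rw [e1, h]
    exact hl.dvd_coeff_mul _ _
  · rw [e2, show 3 * x * n + (x * 2 + d) = x * (3 * n + 2) + d by ring, h]
    exact hl.dvd_coeff_three_mul (n + 1)
  · rw [e3, show 3 * x * n + (x * 1 + d) = x * (3 * n + 1) + d by ring, h,
      ← coeff_succ_trisect_X_mul, h2]
    exact hl.trisect_mul_cubeQuot.dvd_coeff_mul _ _
  -- The shifted index is `9n + 5 = 3(3n + 1) + 2`; `U(X ·)` sends it to `3n + 2`, the class with an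
  -- extra factor 3.
  · rw [e4, show 9 * x * n + (x * 4 + d) = x * (3 * (3 * n + 1) + 1) + d by ring, h,
      ← coeff_succ_trisect_X_mul, h2]
    exact hl.trisect_mul_cubeQuot.dvd_coeff_three_mul_add_two n
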